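/- Let $(R,\mathfrak m,k)$ be a commutative Noetherian Cohen--Macaulay local ring with a canonical module $\omega$, i.e. a maximal Cohen--Macaulay $R$-module (finitely generated, nonzero, with $\operatorname{depth}\omega=\dim\omega=\dim R$) of finite injective dimension and of type $1$, where the type of a finitely generated module $N$ of depth $t$ is $\dim_k\operatorname{Ext}^t_R(k,N)$. Let $M$ be a finitely generated $R$-module. If $\operatorname{Ext}^i_R(M,\omega)$ has finite injective dimension over $R$ for every $i\ge 0$, then $M$ has finite projective dimension over $R$. (The zero module is regarded as having finite injective and finite projective dimension.) -/

import Mathlib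

open CategoryTheory CategoryTheory.Abelian

universe u

/-- The depth of a module `M` over a local ring: the supremum of the lengths of the `M`-regular
sequences contained in the maximal ideal. -/
noncomputable def moduleDepth (R : Type u) [CommRing R] [IsLocalRing R]
    (M : Type u) [AddCommGroup M] [Module R M] : ℕ∞ :=
  sSup {n : ℕ∞ | ∃ rs : List R, (∀ r ∈ rs, r ∈ IsLocalRing.maximalIdeal R) ∧
    RingTheory.Sequence.IsRegular M rs ∧ n = (rs.length : ℕ∞)}

/-- A nonzero finitely generated module over a Noetherian local ring is Cohen-Macaulay if its depth
equals its Krull dimension. -/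
structure IsCohenMacaulayModule (R : Type u) [CommRing R] [IsLocalRing R] [IsNoetherianRing R]
    (M : Type u) [AddCommGroup M] [Module R M] : Prop where
  finite : Module.Finite R M
  nontrivial : Nontrivial M
  depth_eq_dim : (moduleDepth R M : WithBot ℕ∞) = Module.supportDim R M

/-- A Noetherian local ring is Cohen-Macaulay if it is so as a module over itself. -/
def IsCohenMacaulayLocalRing (R : Type u) [CommRing R] [IsLocalRing R] [IsNoetherianRing R] :
    Prop :=
  IsCohenMacaulayModule R R

/-- A maximal Cohen-Macaulay module: a Cohen-Macaulay module of dimension `dim R`. -/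
structure IsMaximalCohenMacaulayModule (R : Type u) [CommRing R] [IsLocalRing R]
    [IsNoetherianRing R] (M : Type u) [AddCommGroup M] [Module R M] : Prop extends
    IsCohenMacaulayModule R M where
  dim_eq : Module.supportDim R M = ringKrullDim R

/-- The `R`-module `Ext_R^i(M, N)`. -/
noncomputable abbrev extModule (R : Type u) [CommRing R] (M N : Type u) [AddCommGroup M]
    [Module R M] [AddCommGroup N] [Module R N] (i : ℕ) : ModuleCat.{u} R :=
  ModuleCat.of R (Ext (ModuleCat.of R M) (ModuleCat.of R N) i)

/-- The maximal ideal annihilates `Ext_R^i(k, M)`, where `k` is the residue field. -/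
theorem extModule_residueField_isTorsionBySet (R : Type u) [CommRing R] [IsLocalRing R]
    (M : Type u) [AddCommGroup M] [Module R M] (i : ℕ) :
    Module.IsTorsionBySet R (extModule R (IsLocalRing.ResidueField R) M i)
      (IsLocalRing.maximalIdeal R : Set R) := by
  rintro x ⟨r, hr⟩
  have h0 : r • 𝟙 (ModuleCat.of R (IsLocalRing.ResidueField R)) = 0 := by
    ext y
    have hy : r • (y : IsLocalRing.ResidueField R) = 0 := by
      rw [Algebra.smul_def, IsLocalRing.ResidueField.algebraMap_eq,
        (IsLocalRing.residue_eq_zero_iff r).2 hr, zero_mul]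
    simpa using hy
  have key : ∀ z : Ext (ModuleCat.of R (IsLocalRing.ResidueField R)) (ModuleCat.of R M) i,
      r • z = 0 := by
    intro z
    have : r • z = (Ext.mk₀ (r • 𝟙 (ModuleCat.of R (IsLocalRing.ResidueField R)))).comp z
        (zero_add i) := by
      simp [Ext.mk₀_smul]
    rw [this, h0]
    simp
  exact key x

/-- The vector space structure of `Ext_R^i(k, M)` over the residue field `k = R / 𝔪`, induced by
its `R`-module structure. -/
noncomputable abbrev extResidueFieldModule (R : Type u) [CommRing R] [IsLocalRing R]
    (M : Type u) [AddCommGroup M] [Module R M] (i : ℕ) :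
    Module (IsLocalRing.ResidueField R) (extModule R (IsLocalRing.ResidueField R) M i) :=
  (extModule_residueField_isTorsionBySet R M i).module

/-- The `i`-th Bass number `dim_k Ext_R^i(k, M)`. -/
noncomputable def bassNumber (R : Type u) [CommRing R] [IsLocalRing R]
    (M : Type u) [AddCommGroup M] [Module R M] (i : ℕ) : ℕ :=
  letI := extResidueFieldModule R M i
  Module.finrank (IsLocalRing.ResidueField R) (extModule R (IsLocalRing.ResidueField R) M i)

/-- The type of a module of (finite) depth `t`: its `t`-th Bass number. -/
noncomputable def moduleType (R : Type u) [CommRing R] [IsLocalRing R]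
    (M : Type u) [AddCommGroup M] [Module R M] : ℕ :=
  bassNumber R M (moduleDepth R M).toNat

/-- `M` has finite injective dimension (the zero module has). -/
def HasFiniteInjDim (R : Type u) [CommRing R] (M : Type u) [AddCommGroup M] [Module R M] : Prop :=
  injectiveDimension (ModuleCat.of R M) ≠ ⊤

/-- `M` has finite projective dimension (the zero module has). -/
def HasFiniteProjDim (R : Type u) [CommRing R] (M : Type u) [AddCommGroup M] [Module R M] : Prop :=
  projectiveDimension (ModuleCat.of R M) ≠ ⊤

/-- A canonical module of a Cohen-Macaulay local ring: a maximal Cohen-Macaulay module of type one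
and of finite injective dimension. -/
structure IsCanonicalModule (R : Type u) [CommRing R] [IsLocalRing R] [IsNoetherianRing R]
    (ω : Type u) [AddCommGroup ω] [Module R ω] : Prop extends
    IsMaximalCohenMacaulayModule R ω where
  type_eq_one : moduleType R ω = 1
  finite_injDim : HasFiniteInjDim R ω

/-! ### Vanishing in long exact sequences of Ext -/

section ExtSequences

variable {C : Type*} [Category C] [Abelian C] [HasExt.{u} C] {S : ShortComplex C}

/-! Write `N†` for `Hom(N, ω)` and `d` for `dim R`. Since `ω` has finite injective dimension,
`Ext^i(M, ω)` vanishes for large `i`. Passing to a syzygy shifts the positive Ext modules down and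
keeps finite injective dimension of the dual (`HasFiniteInjDim.hom_ker`), so it suffices to treat
`N` with all positive `Ext^i(N, ω)` zero and show that it is projective
(`IsCanonicalModule.projective_of_hom`).

Take minimal free covers `F₀ → N` and `F₁ → K₀` with kernels `K₀`, `K₁`. Dualizing keeps these
sequences exact, and `N†`, `K₀†` have finite injective dimension, so `Ext^(d+1)(k, -)` kills both
(`HasFiniteInjDim.subsingleton_ext_residueField`). Minimality then forces `Ext^d(k, K₀†) = Ext^d(k,
K₁†) = 0` (`subsingleton_ext_hom_ker`). Hence `Ext^d(k, F₁†) = 0`; but `F₁†` is a power of `ω` and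
`Ext^d(k, ω) ≠ 0`, so `F₁ = 0`, `K₀ = 0` and `N` is free. -/

theorem subsingleton_ext_X₁_succ (hS : S.ShortExact) {Y : C} {j : ℕ}
    (h₃ : Subsingleton (Ext Y S.X₃ j)) (h₂ : Subsingleton (Ext Y S.X₂ (j + 1))) :
    Subsingleton (Ext Y S.X₁ (j + 1)) := by
  refine subsingleton_of_forall_eq 0 fun x ↦ ?_
  obtain ⟨y, rfl⟩ := Ext.covariant_sequence_exact₁ Y hS x (Subsingleton.elim _ _) rfl
  rw [Subsingleton.elim y 0, Ext.zero_comp]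

theorem subsingleton_ext_X₂ (hS : S.ShortExact) {Y : C} {j : ℕ}
    (h₁ : Subsingleton (Ext Y S.X₁ j)) (h₃ : Subsingleton (Ext Y S.X₃ j)) :
    Subsingleton (Ext Y S.X₂ j) := by
  refine subsingleton_of_forall_eq 0 fun x ↦ ?_
  obtain ⟨y, rfl⟩ := Ext.covariant_sequence_exact₂ Y hS x (Subsingleton.elim _ _)
  rw [Subsingleton.elim y 0, Ext.zero_comp]

theorem subsingleton_ext_X₁_zero (hS : S.ShortExact) {Y : C}
    (h₂ : Subsingleton (Ext Y S.X₂ 0)) : Subsingleton (Ext Y S.X₁ 0) :=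
  have := hS.mono_f
  (Ext.postcomp_mk₀_injective_of_mono Y S.f).subsingleton

/-- If `Ext^(j-1)(Y, X₃)` vanishes, then `Ext^j(Y, X₁) ⟶ Ext^j(Y, X₂)` is injective. -/
theorem ext_eq_zero_of_comp_mk₀_eq_zero (hS : S.ShortExact) {Y : C} {j : ℕ}
    (h₃ : ∀ i, i + 1 = j → Subsingleton (Ext Y S.X₃ i)) (x : Ext Y S.X₁ j)
    (hx : x.comp (Ext.mk₀ S.f) (add_zero j) = 0) : x = 0 := by
  obtain _ | j := j
  · have := hS.mono_f
    exact Ext.postcomp_mk₀_injective_of_mono Y S.f (by simpa using hx)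
  · obtain ⟨y, rfl⟩ := Ext.covariant_sequence_exact₁ Y hS x hx rfl
    have := h₃ j rfl
    rw [Subsingleton.elim y 0, Ext.zero_comp]

theorem subsingleton_ext_contravariant_X₂ (hS : S.ShortExact) {Y : C} {j : ℕ}
    (h₁ : Subsingleton (Ext S.X₁ Y j)) (h₃ : Subsingleton (Ext S.X₃ Y j)) :
    Subsingleton (Ext S.X₂ Y j) := by
  refine subsingleton_of_forall_eq 0 fun x ↦ ?_
  obtain ⟨y, rfl⟩ := Ext.contravariant_sequence_exact₂ hS Y x (Subsingleton.elim _ _)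
  rw [Subsingleton.elim y 0, Ext.comp_zero]

theorem subsingleton_ext_contravariant_X₁ (hS : S.ShortExact) {Y : C} {j : ℕ}
    (h₂ : Subsingleton (Ext S.X₂ Y j)) (h₃ : Subsingleton (Ext S.X₃ Y (j + 1))) :
    Subsingleton (Ext S.X₁ Y j) := by
  refine subsingleton_of_forall_eq 0 fun x ↦ ?_
  obtain ⟨y, rfl⟩ := Ext.contravariant_sequence_exact₁ hS Y x (add_comm 1 j) (Subsingleton.elim _ _)
  rw [Subsingleton.elim y 0, Ext.comp_zero]

theorem subsingleton_ext_of_iso_left {X X' : C} (e : X ≅ X') {Y : C} {j : ℕ}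
    (h : Subsingleton (Ext X Y j)) : Subsingleton (Ext X' Y j) := by
  refine subsingleton_of_forall_eq 0 fun x ↦ ?_
  rw [← x.mk₀_id_comp, ← e.inv_hom_id, ← Ext.mk₀_comp_mk₀_assoc,
    Subsingleton.elim ((Ext.mk₀ e.hom).comp x (zero_add j)) 0, Ext.comp_zero]

theorem subsingleton_ext_of_retract {X Y : C} (r : Retract X Y) {Z : C} {j : ℕ}
    (h : Subsingleton (Ext Z Y j)) : Subsingleton (Ext Z X j) := by
  refine subsingleton_of_forall_eq 0 fun x ↦ ?_
  rw [← x.comp_mk₀_id, ← r.retract, ← Ext.mk₀_comp_mk₀, ← Ext.comp_assoc_of_second_deg_zero,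
    Subsingleton.elim (x.comp (Ext.mk₀ r.i) (add_zero j)) 0, Ext.zero_comp]

end ExtSequences

/-! ### Ext of modules and finite injective dimension -/

section Modules

variable {R : Type u} [CommRing R]

theorem shortExact_of_linearMap {A B C : Type u} [AddCommGroup A] [Module R A] [AddCommGroup B]
    [Module R B] [AddCommGroup C] [Module R C] (f : A →ₗ[R] B) (g : B →ₗ[R] C)
    (hf : Function.Injective f) (hfg : Function.Exact f g) (hg : Function.Surjective g) :
    (ModuleCat.shortComplexOfCompEqZero f g hfg.linearMap_comp_eq_zero).ShortExact where
  exact := ModuleCat.shortComplex_exact _ hfg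
  mono_f := (ModuleCat.mono_iff_injective _).2 hf
  epi_g := (ModuleCat.epi_iff_surjective _).2 hg

theorem subsingleton_ext_pi {Y : ModuleCat.{u} R} {X : Type u} [AddCommGroup X] [Module R X]
    {j : ℕ} (h : Subsingleton (Ext Y (ModuleCat.of R X) j)) (n : ℕ) :
    Subsingleton (Ext Y (ModuleCat.of R (Fin n → X)) j) := by
  refine subsingleton_of_forall_eq 0 fun x ↦ ?_
  -- The identity is a finite sum of maps factoring through `X`, so every class on the power is a
  -- sum of zeros.
  have hid : 𝟙 (ModuleCat.of R (Fin n → X)) =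
      ∑ i : Fin n, ModuleCat.ofHom (LinearMap.proj i : (Fin n → X) →ₗ[R] X) ≫
        ModuleCat.ofHom (LinearMap.single R (fun _ : Fin n ↦ X) i) := by
    ext v i
    simp [ModuleCat.hom_sum, Pi.single_apply]
  have key : ∀ (s : Finset (Fin n)), x.comp (Ext.mk₀ (∑ i ∈ s,
      ModuleCat.ofHom (LinearMap.proj i : (Fin n → X) →ₗ[R] X) ≫
        ModuleCat.ofHom (LinearMap.single R (fun _ : Fin n ↦ X) i))) (add_zero j) = 0 := by
    intro s
    induction s using Finset.induction_on with
    | empty => simp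
    | insert a s ha ih =>
      rw [Finset.sum_insert ha, Ext.mk₀_add, Ext.comp_add, ih, add_zero, ← Ext.mk₀_comp_mk₀,
        ← Ext.comp_assoc_of_second_deg_zero,
        Subsingleton.elim (x.comp (Ext.mk₀ (ModuleCat.ofHom
          (LinearMap.proj a : (Fin n → X) →ₗ[R] X))) (add_zero j)) 0, Ext.zero_comp]
  rw [← x.comp_mk₀_id, hid]
  exact key _

/-- Postcomposing with a linear map in `I • Hom(A, B)` is zero on `Ext(Y, -)` if `I` kills `Y`. -/
theorem ext_comp_mk₀_eq_zero_of_mem_smul {I : Ideal R} {Y : ModuleCat.{u} R}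
    (hY : I ≤ Module.annihilator R Y) {A B : Type u} [AddCommGroup A] [Module R A]
    [AddCommGroup B] [Module R B] {f : A →ₗ[R] B} (hf : f ∈ I • (⊤ : Submodule R (A →ₗ[R] B)))
    {j : ℕ} (x : Ext Y (ModuleCat.of R A) j) :
    x.comp (Ext.mk₀ (ModuleCat.ofHom f)) (add_zero j) = 0 := by
  refine Submodule.smul_induction_on hf (fun r hr g _ ↦ ?_) (fun g₁ g₂ h₁ h₂ ↦ ?_)
  · have h0 : r • 𝟙 Y = 0 := by
      ext y
      exact Module.mem_annihilator.1 (hY hr) y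
    have hx : r • x = 0 := by
      have : r • x = (Ext.mk₀ (r • 𝟙 Y)).comp x (zero_add j) := by simp [Ext.mk₀_smul]
      rw [this, h0]
      simp
    have : ModuleCat.ofHom (r • g) = r • ModuleCat.ofHom g := rfl
    rw [this, Ext.mk₀_smul, Ext.comp_smul, ← Ext.smul_comp, hx, Ext.zero_comp]
  · have : ModuleCat.ofHom (g₁ + g₂) = ModuleCat.ofHom g₁ + ModuleCat.ofHom g₂ := rfl
    rw [this, Ext.mk₀_add, Ext.comp_add, h₁, h₂, add_zero]

theorem hasFiniteInjDim_iff {M : Type u} [AddCommGroup M] [Module R M] :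
    HasFiniteInjDim R M ↔ ∃ n, ∀ m, n ≤ m → HasInjectiveDimensionLT (ModuleCat.of R M) m := by
  rw [HasFiniteInjDim, injectiveDimension_ne_top_iff]
  refine ⟨fun ⟨n, hn⟩ ↦ ⟨n + 1, fun m hm ↦ ?_⟩, fun ⟨n, hn⟩ ↦ ⟨n, hn _ n.le_succ⟩⟩
  have : HasInjectiveDimensionLT (ModuleCat.of R M) (n + 1) := hn
  exact hasInjectiveDimensionLT_of_ge _ (n + 1) m hm

section

variable {A B C : Type u} [AddCommGroup A] [Module R A] [AddCommGroup B] [Module R B]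
  [AddCommGroup C] [Module R C] {f : A →ₗ[R] B} {g : B →ₗ[R] C}

theorem HasFiniteInjDim.of_linearEquiv (h : HasFiniteInjDim R A) (e : A ≃ₗ[R] B) :
    HasFiniteInjDim R B := by
  rwa [HasFiniteInjDim, ← injectiveDimension_eq_of_iso e.toModuleIso]

theorem HasFiniteInjDim.right_of_exact (hA : HasFiniteInjDim R A) (hB : HasFiniteInjDim R B)
    (hf : Function.Injective f) (hfg : Function.Exact f g) (hg : Function.Surjective g) :
    HasFiniteInjDim R C := by
  rw [hasFiniteInjDim_iff] at *
  obtain ⟨a, ha⟩ := hA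
  obtain ⟨b, hb⟩ := hB
  exact ⟨max a b, fun m hm ↦ (shortExact_of_linearMap f g hf hfg hg).hasInjectiveDimensionLT_X₃ m
    (hb m (by omega)) (ha (m + 1) (by omega))⟩

theorem HasFiniteInjDim.middle_of_exact (hA : HasFiniteInjDim R A) (hC : HasFiniteInjDim R C)
    (hf : Function.Injective f) (hfg : Function.Exact f g) (hg : Function.Surjective g) :
    HasFiniteInjDim R B := by
  rw [hasFiniteInjDim_iff] at *
  obtain ⟨a, ha⟩ := hA
  obtain ⟨b, hb⟩ := hC
  exact ⟨max a b, fun m hm ↦ (shortExact_of_linearMap f g hf hfg hg).hasInjectiveDimensionLT_X₂ m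
    (ha m (by omega)) (hb m (by omega))⟩

end

theorem HasFiniteInjDim.pi {X : Type u} [AddCommGroup X] [Module R X] (h : HasFiniteInjDim R X)
    (n : ℕ) : HasFiniteInjDim R (Fin n → X) := by
  rw [hasFiniteInjDim_iff] at *
  obtain ⟨a, ha⟩ := h
  refine ⟨a, fun m hm ↦ HasInjectiveDimensionLT.mk fun i hi Y e ↦ ?_⟩
  have := ha m hm
  have := subsingleton_ext_pi (HasInjectiveDimensionLT.subsingleton (ModuleCat.of R X) m i hi Y) n
  exact Subsingleton.elim _ _

end Modules

open IsLocalRing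

/-! ### Bass numbers over a local ring -/

section LocalRing

variable {R : Type u} [CommRing R] [IsLocalRing R]

theorem nonempty_residueField_linearEquiv_of_isSimpleModule (S : Type u) [AddCommGroup S]
    [Module R S] [IsSimpleModule R S] : Nonempty (ResidueField R ≃ₗ[R] S) := by
  obtain ⟨I, hI, ⟨e⟩⟩ := isSimpleModule_iff_quot_maximal.1 (inferInstance : IsSimpleModule R S)
  obtain rfl := eq_maximalIdeal hI
  exact ⟨e.symm⟩

/-- Vanishing of `Ext^j(k, X)` propagates to all modules of finite length. -/
theorem IsFiniteLength.subsingleton_ext {M : Type u} [AddCommGroup M] [Module R M]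
    (hM : IsFiniteLength R M) {X : ModuleCat.{u} R} {j : ℕ}
    (hk : Subsingleton (Ext (ModuleCat.of R (ResidueField R)) X j)) :
    Subsingleton (Ext (ModuleCat.of R M) X j) := by
  induction hM with
  | @of_subsingleton M _ _ _ =>
    have hz : Limits.IsZero (ModuleCat.of R M) := ModuleCat.isZero_of_subsingleton _
    refine subsingleton_of_forall_eq 0 fun x ↦ ?_
    rw [← x.mk₀_id_comp, hz.eq_zero_of_src (𝟙 _), Ext.mk₀_zero, Ext.zero_comp]
  | @of_simple_quotient M _ _ N _ _ ih =>
    obtain ⟨e⟩ := nonempty_residueField_linearEquiv_of_isSimpleModule (R := R) (M ⧸ N)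
    exact subsingleton_ext_contravariant_X₂
      (shortExact_of_linearMap N.subtype N.mkQ N.injective_subtype
        (LinearMap.exact_subtype_mkQ N) N.mkQ_surjective) ih
      (subsingleton_ext_of_iso_left e.toModuleIso hk)

variable [IsNoetherianRing R]

theorem exists_isRegular_length_eq {M : Type u} [AddCommGroup M] [Module R M]
    (hM : IsCohenMacaulayModule R M) {d : ℕ} (hd : Module.supportDim R M = d) :
    moduleDepth R M = d ∧ ∃ rs : List R, (∀ r ∈ rs, r ∈ maximalIdeal R) ∧
      RingTheory.Sequence.IsRegular M rs ∧ rs.length = d := by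
  have := hM.nontrivial
  have h : moduleDepth R M = d := by
    have := hM.depth_eq_dim.trans hd
    exact_mod_cast this
  refine ⟨h, ?_⟩
  have hne : Nonempty {n : ℕ∞ | ∃ rs : List R, (∀ r ∈ rs, r ∈ maximalIdeal R) ∧
      RingTheory.Sequence.IsRegular M rs ∧ n = (rs.length : ℕ∞)} :=
    ⟨0, [], by simp, RingTheory.Sequence.IsRegular.nil R M, by simp⟩
  have hlt : sSup {n : ℕ∞ | ∃ rs : List R, (∀ r ∈ rs, r ∈ maximalIdeal R) ∧
      RingTheory.Sequence.IsRegular M rs ∧ n = (rs.length : ℕ∞)} = d := h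
  obtain ⟨rs, h₁, h₂, h₃⟩ := ENat.sSup_mem_of_nonempty_of_lt_top (hlt ▸ ENat.natCast_lt_top d)
  refine ⟨rs, h₁, h₂, ?_⟩
  rw [hlt] at h₃
  exact_mod_cast h₃.symm

/-- Over a Cohen-Macaulay local ring of dimension `d`, the Bass numbers of a module of finite
injective dimension vanish beyond `d`. -/
theorem HasFiniteInjDim.subsingleton_ext_residueField (hR : IsCohenMacaulayLocalRing R) {d : ℕ}
    (hd : ringKrullDim R = d) {X : Type u} [AddCommGroup X] [Module R X]
    (hX : HasFiniteInjDim R X) {j : ℕ} (hj : d < j) :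
    Subsingleton (Ext (ModuleCat.of R (ResidueField R)) (ModuleCat.of R X) j) := by
  obtain ⟨-, rs, hrs, hreg, hlen⟩ := exists_isRegular_length_eq hR
    (by rw [Module.supportDim_self_eq_ringKrullDim, hd])
  set I := Ideal.ofList rs with hI
  have hIm : I ≤ maximalIdeal R := Ideal.span_le.2 hrs
  have hItop : I ≠ ⊤ := fun h ↦ (maximalIdeal.isMaximal R).ne_top (top_le_iff.1 (h ▸ hIm))
  have : Nontrivial (R ⧸ I) := Ideal.Quotient.nontrivial_iff.2 hItop
  have hdim : ringKrullDim (R ⧸ I) = 0 := by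
    have := ringKrullDim_add_length_eq_ringKrullDim_of_isRegular rs hreg
    rw [hd, hlen] at this
    exact ENat.WithBot.add_natCast_cancel.1 (this.trans (zero_add _).symm)
  have hart : IsArtinianRing (R ⧸ I) := by
    have : Ring.KrullDimLE 0 (R ⧸ I) := by
      rw [Ring.krullDimLE_iff, hdim]; rfl
    exact isArtinianRing_iff_isNoetherianRing_krullDimLE_zero.2 ⟨inferInstance, this⟩
  have hartR : IsArtinian R (R ⧸ I) := isArtinian_of_surjective_algebraMap (R := R ⧸ I) Ideal.Quotient.mk_surjective
  -- The nonzero Artinian module `R ⧸ I` contains a copy of `k`, with cokernel of finite length.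
  obtain ⟨S, hS, -⟩ := (eq_bot_or_exists_atom_le (⊤ : Submodule R (R ⧸ I))).resolve_left
    (by simp)
  have : IsSimpleModule R S := isSimpleModule_iff_isAtom.2 hS
  obtain ⟨e⟩ := nonempty_residueField_linearEquiv_of_isSimpleModule (R := R) S
  have hC : IsFiniteLength R ((R ⧸ I) ⧸ S) :=
    isFiniteLength_iff_isNoetherian_isArtinian.2 ⟨inferInstance, inferInstance⟩
  have hpd : HasProjectiveDimensionLT (ModuleCat.of R (R ⧸ I)) (d + 1) := by
    have h := ModuleCat.projectiveDimension_quotient_eq_length.{u} rs hreg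
    rw [projectiveDimension_eq_of_iso (Shrink.linearEquiv R (R ⧸ I)).toModuleIso, hlen] at h
    exact (projectiveDimension_le_iff _ d).1 h.le
  obtain ⟨n, hn⟩ := hasFiniteInjDim_iff.1 hX
  -- Descending induction on `i`: `Ext^i(k, X)` sits between `Ext^i(R ⧸ I, X)`, zero as `R ⧸ I` has
  -- projective dimension `d`, and `Ext^(i+1)` of the cokernel, zero by the case `i + 1`.
  have key : ∀ m i, d < i → n ≤ i + m →
      Subsingleton (Ext (ModuleCat.of R (ResidueField R)) (ModuleCat.of R X) i) := by
    intro m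
    induction m with
    | zero =>
      intro i _ hi
      have := hn i hi
      exact HasInjectiveDimensionLT.subsingleton (ModuleCat.of R X) i i le_rfl _
    | succ m ih =>
      intro i hdi hi
      exact subsingleton_ext_of_iso_left e.symm.toModuleIso <|
        subsingleton_ext_contravariant_X₁
          (shortExact_of_linearMap S.subtype S.mkQ S.injective_subtype
            (LinearMap.exact_subtype_mkQ S) S.mkQ_surjective)
          (HasProjectiveDimensionLT.subsingleton (ModuleCat.of R (R ⧸ I)) (d + 1) i hdi _)
          (hC.subsingleton_ext (ih (i + 1) (by omega) (by omega)))
  exact key n j hj (by omega)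

theorem subsingleton_ext_residueField_of_lt {M : Type u} [AddCommGroup M] [Module R M]
    (hM : IsCohenMacaulayModule R M) {d : ℕ} (hd : Module.supportDim R M = d) {j : ℕ}
    (hj : j < d) :
    Subsingleton (Ext (ModuleCat.of R (ResidueField R)) (ModuleCat.of R M) j) := by
  obtain ⟨-, rs, hrs, hreg, rfl⟩ := exists_isRegular_length_eq hM hd
  have := hM.finite
  have := hM.nontrivial
  refine ModuleCat.subsingleton_ext_of_exists_isRegular (maximalIdeal R)
    (ModuleCat.of R (ResidueField R)) ?_ (ModuleCat.of R M) ?_ rs hrs hreg j hj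
  · rw [Module.support_eq_zeroLocus]
    exact PrimeSpectrum.zeroLocus_anti_mono (Ideal.annihilator_quotient (I := maximalIdeal R)).ge
  · exact (Submodule.top_ne_ideal_smul_of_le_jacobson_annihilator
      (maximalIdeal_le_jacobson _)).symm.lt_top

/-- As `ω` is maximal Cohen-Macaulay, its depth is `d`, so its type is the `d`-th Bass number. -/
theorem IsCanonicalModule.nontrivial_ext {ω : Type u} [AddCommGroup ω] [Module R ω]
    (hω : IsCanonicalModule R ω) {d : ℕ} (hd : ringKrullDim R = d) :
    Nontrivial (Ext (ModuleCat.of R (ResidueField R)) (ModuleCat.of R ω) d) := by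
  have h := hω.type_eq_one
  rw [moduleType, (exists_isRegular_length_eq hω.toIsCohenMacaulayModule
    (hω.dim_eq.trans hd)).1, ENat.toNat_natCast, bassNumber] at h
  let := extResidueFieldModule R ω d
  exact Module.nontrivial_of_finrank_pos (R := ResidueField R)
    (M := extModule R (ResidueField R) ω d) (by rw [h]; exact one_pos)

end LocalRing

/-! ### Dualizing a free cover into `ω` -/

section HomSequence

variable {R : Type u} [CommRing R] {N F : Type u} [AddCommGroup N] [Module R N] [AddCommGroup F]
  [Module R F] {ω : Type u} [AddCommGroup ω] [Module R ω] {g : F →ₗ[R] N}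

theorem shortExact_ker (hg : Function.Surjective g) :
    (ModuleCat.shortComplexOfCompEqZero (LinearMap.ker g).subtype g
      (g.exact_subtype_ker_map).linearMap_comp_eq_zero).ShortExact :=
  shortExact_of_linearMap _ g (LinearMap.ker g).injective_subtype g.exact_subtype_ker_map hg

theorem exact_lcomp_ker (hg : Function.Surjective g) :
    Function.Exact (LinearMap.lcomp R ω g) (LinearMap.lcomp R ω (LinearMap.ker g).subtype) :=
  LinearMap.exact_lcomp_of_exact_of_surjective ω g.exact_subtype_ker_map hg

theorem surjective_lcomp_ker (hg : Function.Surjective g)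
    (h : Subsingleton (Ext (ModuleCat.of R N) (ModuleCat.of R ω) 1)) :
    Function.Surjective (LinearMap.lcomp R ω (LinearMap.ker g).subtype) := by
  intro φ
  obtain ⟨x, hx⟩ := Ext.contravariant_sequence_exact₁ (shortExact_ker hg) (ModuleCat.of R ω)
    (Ext.mk₀ (ModuleCat.ofHom φ)) (add_zero 1) (Subsingleton.elim _ _)
  obtain ⟨ψ, rfl⟩ := (Ext.mk₀_bijective _ _).2 x
  rw [Ext.mk₀_comp_mk₀] at hx
  exact ⟨ψ.hom, congrArg ModuleCat.Hom.hom ((Ext.mk₀_bijective _ _).1 hx)⟩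

theorem shortExact_lcomp_ker (hg : Function.Surjective g)
    (h : Subsingleton (Ext (ModuleCat.of R N) (ModuleCat.of R ω) 1)) :
    (ModuleCat.shortComplexOfCompEqZero (LinearMap.lcomp R ω g)
      (LinearMap.lcomp R ω (LinearMap.ker g).subtype)
      (exact_lcomp_ker hg).linearMap_comp_eq_zero).ShortExact :=
  shortExact_of_linearMap _ _ (LinearMap.lcomp_injective_of_surjective g hg)
    (exact_lcomp_ker hg) (surjective_lcomp_ker hg h)

variable [Module.Projective R F]

theorem ext_eq_zero_of_module_projective {X : ModuleCat.{u} R} {i : ℕ}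
    (x : Ext (ModuleCat.of R F) X (i + 1)) : x = 0 :=
  have : Projective (ModuleCat.of R F) := (IsProjective.iff_projective F).1 inferInstance
  Ext.eq_zero_of_projective x

/-- Dimension shifting: `Ext^(i+1)(K, ω) ≃ Ext^(i+2)(N, ω)` for `K` a syzygy of `N`. -/
theorem nonempty_ext_ker_linearEquiv (hg : Function.Surjective g) (i : ℕ) :
    Nonempty (Ext (ModuleCat.of R N) (ModuleCat.of R ω) (i + 2) ≃ₗ[R]
      Ext (ModuleCat.of R (LinearMap.ker g)) (ModuleCat.of R ω) (i + 1)) := by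
  let δ : Ext (ModuleCat.of R (LinearMap.ker g)) (ModuleCat.of R ω) (i + 1) →ₗ[R]
      Ext (ModuleCat.of R N) (ModuleCat.of R ω) (i + 2) :=
    (shortExact_ker hg).extClass.precompOfLinear R (ModuleCat.of R ω) (by omega)
  refine ⟨(LinearEquiv.ofBijective δ ⟨?_, fun x ↦ ?_⟩).symm⟩
  · rw [← LinearMap.ker_eq_bot, LinearMap.ker_eq_bot']
    intro x hx
    obtain ⟨y, rfl⟩ := Ext.contravariant_sequence_exact₁ (shortExact_ker hg) (ModuleCat.of R ω) x
      (by omega : 1 + (i + 1) = i + 2) hx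
    have : y = 0 := ext_eq_zero_of_module_projective (F := F) y
    rw [this, Ext.comp_zero]
  · exact Ext.contravariant_sequence_exact₃ (shortExact_ker hg) (ModuleCat.of R ω) x
      (ext_eq_zero_of_module_projective (F := F) _) (by omega)

/-- The exact sequence `Hom(F, ω) ⟶ Hom(K, ω) ⟶ Ext^1(N, ω) ⟶ 0` for `K` a syzygy of `N`. -/
theorem exists_linearMap_ext_one (hg : Function.Surjective g) :
    ∃ δ : (LinearMap.ker g →ₗ[R] ω) →ₗ[R] Ext (ModuleCat.of R N) (ModuleCat.of R ω) 1,
      Function.Surjective δ ∧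
        Function.Exact (LinearMap.lcomp R ω (LinearMap.ker g).subtype) δ := by
  let e : (LinearMap.ker g →ₗ[R] ω) ≃ₗ[R]
      Ext (ModuleCat.of R (LinearMap.ker g)) (ModuleCat.of R ω) 0 :=
    (ModuleCat.homLinearEquiv (S := R) (M := ModuleCat.of R (LinearMap.ker g))
      (N := ModuleCat.of R ω)).symm.trans (Ext.linearEquiv₀ (R := R)).symm
  let δ : Ext (ModuleCat.of R (LinearMap.ker g)) (ModuleCat.of R ω) 0 →ₗ[R]
      Ext (ModuleCat.of R N) (ModuleCat.of R ω) 1 :=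
    (shortExact_ker hg).extClass.precompOfLinear R (ModuleCat.of R ω) (add_zero 1)
  have hδ : Function.Surjective δ := fun x ↦
    Ext.contravariant_sequence_exact₃ (shortExact_ker hg) (ModuleCat.of R ω) x
      (ext_eq_zero_of_module_projective (F := F) _) (add_zero 1)
  refine ⟨δ ∘ₗ e.toLinearMap, hδ.comp e.surjective, fun φ ↦ ⟨fun hφ ↦ ?_, ?_⟩⟩
  · obtain ⟨x, hx⟩ := Ext.contravariant_sequence_exact₁ (shortExact_ker hg) (ModuleCat.of R ω)
      (Ext.mk₀ (ModuleCat.ofHom φ)) (add_zero 1) hφ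
    obtain ⟨ψ, rfl⟩ := (Ext.mk₀_bijective _ _).2 x
    rw [Ext.mk₀_comp_mk₀] at hx
    exact ⟨ψ.hom, congrArg ModuleCat.Hom.hom ((Ext.mk₀_bijective _ _).1 hx)⟩
  · rintro ⟨ψ, rfl⟩
    change (shortExact_ker hg).extClass.comp
      (Ext.mk₀ (ModuleCat.ofHom (LinearMap.ker g).subtype ≫ ModuleCat.ofHom ψ)) (add_zero 1) = 0
    rw [← Ext.mk₀_comp_mk₀]
    exact (shortExact_ker hg).extClass_comp_assoc _

/-- The sequence `0 → N† → F† → K† → Ext^1(N, ω) → 0` is split at the image of the restriction map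
`F† → K†`. -/
theorem HasFiniteInjDim.hom_ker (hg : Function.Surjective g)
    (hF : HasFiniteInjDim R (F →ₗ[R] ω)) (h₀ : HasFiniteInjDim R (N →ₗ[R] ω))
    (h₁ : HasFiniteInjDim R (extModule R N ω 1)) :
    HasFiniteInjDim R (LinearMap.ker g →ₗ[R] ω) := by
  obtain ⟨δ, hδ, hex⟩ := exists_linearMap_ext_one (ω := ω) hg
  set ρ := LinearMap.lcomp R ω (LinearMap.ker g).subtype with hρ
  have hI : HasFiniteInjDim R (LinearMap.range ρ) := by
    refine h₀.right_of_exact (f := LinearMap.lcomp R ω g) (g := ρ.rangeRestrict) hF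
      (LinearMap.lcomp_injective_of_surjective g hg) (fun φ ↦ ?_) ρ.surjective_rangeRestrict
    rw [← exact_lcomp_ker hg φ, Subtype.ext_iff]
    rfl
  refine hI.middle_of_exact (f := (LinearMap.range ρ).subtype) (g := δ) h₁
    (LinearMap.range ρ).injective_subtype (fun φ ↦ ?_) hδ
  rw [hex φ]
  simp

end HomSequence

/-! ### Minimal free covers -/

section FreeCover

variable {R : Type u} [CommRing R]

theorem mem_ideal_smul_top_of_forall_mem {I : Ideal R} {n : ℕ} {v : Fin n → R}
    (h : ∀ i, v i ∈ I) : v ∈ I • (⊤ : Submodule R (Fin n → R)) := by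
  rw [pi_eq_sum_univ' v]
  exact Submodule.sum_mem _ fun i _ ↦ Submodule.smul_mem_smul (h i) trivial

/-- A linear map out of a finite free module with image in `I • F` lies in `I • Hom`. -/
theorem mem_ideal_smul_top_of_range_le {I : Ideal R} {F : Type u} [AddCommGroup F] [Module R F]
    {n : ℕ} {f : (Fin n → R) →ₗ[R] F} (h : LinearMap.range f ≤ I • ⊤) :
    f ∈ I • (⊤ : Submodule R ((Fin n → R) →ₗ[R] F)) := by
  have hf : f = ∑ i, (LinearMap.proj i : (Fin n → R) →ₗ[R] R).smulRight (f (Pi.single i 1)) := by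
    ext i
    simp [Pi.single_apply]
  rw [hf]
  refine Submodule.sum_mem _ fun i _ ↦ ?_
  refine Submodule.smul_induction_on (h (LinearMap.mem_range_self f (Pi.single i 1)))
    (fun r hr w _ ↦ ?_) (fun w₁ w₂ h₁ h₂ ↦ ?_)
  · have : (LinearMap.proj i : (Fin n → R) →ₗ[R] R).smulRight (r • w) =
        r • (LinearMap.proj i : (Fin n → R) →ₗ[R] R).smulRight w := by
      ext; simp [smul_comm r]
    rw [this]
    exact Submodule.smul_mem_smul hr trivial
  · have : (LinearMap.proj i : (Fin n → R) →ₗ[R] R).smulRight (w₁ + w₂) =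
        (LinearMap.proj i : (Fin n → R) →ₗ[R] R).smulRight w₁ +
          (LinearMap.proj i : (Fin n → R) →ₗ[R] R).smulRight w₂ := by
      ext; simp
    rw [this]
    exact Submodule.add_mem _ h₁ h₂

theorem lcomp_mem_ideal_smul_top {I : Ideal R} {A B ω : Type u} [AddCommGroup A] [Module R A]
    [AddCommGroup B] [Module R B] [AddCommGroup ω] [Module R ω] {f : A →ₗ[R] B}
    (hf : f ∈ I • (⊤ : Submodule R (A →ₗ[R] B))) :
    LinearMap.lcomp R ω f ∈ I • (⊤ : Submodule R ((B →ₗ[R] ω) →ₗ[R] (A →ₗ[R] ω))) := by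
  refine Submodule.smul_induction_on hf (fun r hr w _ ↦ ?_) (fun w₁ w₂ h₁ h₂ ↦ ?_)
  · have : LinearMap.lcomp R ω (r • w) = r • LinearMap.lcomp R ω w := by
      ext; simp
    rw [this]
    exact Submodule.smul_mem_smul hr trivial
  · have : LinearMap.lcomp R ω (w₁ + w₂) = LinearMap.lcomp R ω w₁ + LinearMap.lcomp R ω w₂ := by
      ext; simp
    rw [this]
    exact Submodule.add_mem _ h₁ h₂

variable [IsLocalRing R]

/-- A finitely generated module over a local ring has a minimal finite free cover. -/
theorem exists_minimal_free_cover (N : Type u) [AddCommGroup N] [Module R N] [Module.Finite R N] :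
    ∃ (n : ℕ) (g : (Fin n → R) →ₗ[R] N), Function.Surjective g ∧
      LinearMap.ker g ≤ maximalIdeal R • ⊤ := by
  classical
  have hex : ∃ (n : ℕ) (g : (Fin n → R) →ₗ[R] N), Function.Surjective g :=
    Module.Finite.exists_fin' R N
  obtain ⟨g, hg⟩ := Nat.find_spec hex
  have hmin := fun m ↦ Nat.find_min (m := m) hex
  generalize Nat.find hex = n at g hg hmin
  refine ⟨n, g, hg, fun v hv ↦ mem_ideal_smul_top_of_forall_mem fun i ↦ ?_⟩
  by_contra hi
  obtain ⟨c, hc⟩ := (notMem_maximalIdeal.1 hi).exists_left_inv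
  obtain _ | m := n
  · exact i.elim0
  let ι : (Fin m → R) →ₗ[R] (Fin (m + 1) → R) :=
    { toFun w := i.insertNth 0 w
      map_add' w₁ w₂ := by
        ext j
        refine Fin.succAboveCases i ?_ (fun k ↦ ?_) j <;> simp
      map_smul' r w := by
        ext j
        refine Fin.succAboveCases i ?_ (fun k ↦ ?_) j <;> simp }
  -- A relation `v` whose `i`-th coordinate is a unit makes the `i`-th generator redundant, against
  -- the minimality of the rank.
  refine hmin m m.lt_succ_self ⟨g ∘ₗ ι, fun y ↦ ?_⟩
  obtain ⟨u, rfl⟩ := hg y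
  refine ⟨i.removeNth (u - (u i * c) • v), ?_⟩
  have h0 : ι (i.removeNth (u - (u i * c) • v)) = u - (u i * c) • v := by
    ext j
    refine Fin.succAboveCases i ?_ (fun k ↦ ?_) j
    · simp [ι, mul_assoc, hc]
    · simp [ι, Fin.removeNth]
  rw [LinearMap.comp_apply, h0, map_sub, map_smul, LinearMap.mem_ker.1 hv, smul_zero, sub_zero]

end FreeCover

/-! ### Projectivity from duals, and descent along syzygies -/

section Main

variable {R : Type u} [CommRing R]

theorem subsingleton_ext_hom_pi {Y : ModuleCat.{u} R} {ω : Type u} [AddCommGroup ω] [Module R ω]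
    {j : ℕ} (h : Subsingleton (Ext Y (ModuleCat.of R ω) j)) (n : ℕ) :
    Subsingleton (Ext Y (ModuleCat.of R ((Fin n → R) →ₗ[R] ω)) j) :=
  let e : (Fin n → ω) ≃ₗ[R] ((Fin n → R) →ₗ[R] ω) := (Pi.basisFun R (Fin n)).constr R
  subsingleton_ext_of_retract (.ofIso e.symm.toModuleIso) (subsingleton_ext_pi h n)

theorem HasFiniteInjDim.hom_pi {ω : Type u} [AddCommGroup ω] [Module R ω]
    (h : HasFiniteInjDim R ω) (n : ℕ) : HasFiniteInjDim R ((Fin n → R) →ₗ[R] ω) :=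
  (h.pi n).of_linearEquiv ((Pi.basisFun R (Fin n)).constr R)

variable [IsNoetherianRing R]

/-- `N†` embeds in a power of `ω` with cokernel the dual of a syzygy, which satisfies the same
hypotheses; each step lowers `j` by one. -/
theorem subsingleton_ext_hom_of_lt {Y : ModuleCat.{u} R} {ω : Type u} [AddCommGroup ω]
    [Module R ω] {d : ℕ} (hY : ∀ j < d, Subsingleton (Ext Y (ModuleCat.of R ω) j))
    {N : Type u} [AddCommGroup N] [Module R N] [Module.Finite R N]
    (hN : ∀ i, Subsingleton (Ext (ModuleCat.of R N) (ModuleCat.of R ω) (i + 1)))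
    {j : ℕ} (hj : j < d) : Subsingleton (Ext Y (ModuleCat.of R (N →ₗ[R] ω)) j) := by
  induction j generalizing N with
  | zero =>
    obtain ⟨n, g, hg⟩ := Module.Finite.exists_fin' R N
    exact subsingleton_ext_X₁_zero (shortExact_lcomp_ker hg (hN 0))
      (subsingleton_ext_hom_pi (hY 0 hj) n)
  | succ j ih =>
    obtain ⟨n, g, hg⟩ := Module.Finite.exists_fin' R N
    refine subsingleton_ext_X₁_succ (shortExact_lcomp_ker hg (hN 0)) (ih (fun i ↦ ?_) (by omega))
      (subsingleton_ext_hom_pi (hY _ hj) n)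
    obtain ⟨e⟩ := nonempty_ext_ker_linearEquiv (ω := ω) hg i
    have := hN (i + 1)
    exact e.symm.toEquiv.subsingleton

variable [IsLocalRing R]

/-- With `F → N` the given cover, `K` its kernel and `G → K` a free cover, `Ext^d(k, F†) → Ext^d(k,
K†)` is onto and `Ext^d(k, K†) → Ext^d(k, G†)` is injective. The composite is induced by `G → F`,
whose image lies in `𝔪F`, so it is zero because `𝔪` kills `k`. -/
theorem subsingleton_ext_hom_ker {ω : Type u} [AddCommGroup ω] [Module R ω] {d : ℕ}
    (hk : ∀ j < d, Subsingleton (Ext (ModuleCat.of R (ResidueField R)) (ModuleCat.of R ω) j))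
    {N : Type u} [AddCommGroup N] [Module R N]
    (hN : ∀ i, Subsingleton (Ext (ModuleCat.of R N) (ModuleCat.of R ω) (i + 1)))
    (hd : Subsingleton
      (Ext (ModuleCat.of R (ResidueField R)) (ModuleCat.of R (N →ₗ[R] ω)) (d + 1)))
    {n : ℕ} {g : (Fin n → R) →ₗ[R] N} (hg : Function.Surjective g)
    (hmin : LinearMap.ker g ≤ maximalIdeal R • ⊤) :
    Subsingleton (Ext (ModuleCat.of R (ResidueField R))
      (ModuleCat.of R (LinearMap.ker g →ₗ[R] ω)) d) := by
  have hK (i : ℕ) : Subsingleton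
      (Ext (ModuleCat.of R (LinearMap.ker g)) (ModuleCat.of R ω) (i + 1)) := by
    obtain ⟨e⟩ := nonempty_ext_ker_linearEquiv (ω := ω) hg i
    have := hN (i + 1)
    exact e.symm.toEquiv.subsingleton
  obtain ⟨m, g', hg'⟩ := Module.Finite.exists_fin' R (LinearMap.ker g)
  have hK' (i : ℕ) : Subsingleton
      (Ext (ModuleCat.of R (LinearMap.ker g')) (ModuleCat.of R ω) (i + 1)) := by
    obtain ⟨e⟩ := nonempty_ext_ker_linearEquiv (ω := ω) hg' i
    have := hK (i + 1)
    exact e.symm.toEquiv.subsingleton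
  have hann : maximalIdeal R ≤
      Module.annihilator R (ModuleCat.of R (ResidueField R)) :=
    (Ideal.annihilator_quotient (I := maximalIdeal R)).ge
  refine subsingleton_of_forall_eq 0 fun x ↦ ?_
  refine ext_eq_zero_of_comp_mk₀_eq_zero (shortExact_lcomp_ker hg' (hK 0))
    -- Injectivity needs only degree `d - 1` of the dual of the next syzygy; for `d = 0` the
    -- condition is empty.
    (fun i hi ↦ subsingleton_ext_hom_of_lt hk hK' (by omega)) x ?_
  obtain ⟨y, rfl⟩ := Ext.covariant_sequence_exact₃ _ (shortExact_lcomp_ker hg (hN 0)) x rfl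
    (Subsingleton.elim _ _)
  rw [Ext.comp_assoc_of_second_deg_zero, Ext.mk₀_comp_mk₀]
  refine ext_comp_mk₀_eq_zero_of_mem_smul hann
    (f := LinearMap.lcomp R ω ((LinearMap.ker g).subtype ∘ₗ g'))
    (lcomp_mem_ideal_smul_top (mem_ideal_smul_top_of_range_le ?_)) y
  rintro _ ⟨v, rfl⟩
  exact hmin (g' v).2

/-- A finitely generated `N` with `Ext^i(N, ω) = 0` for `i > 0` and `Hom(N, ω)` of finite injective
dimension is projective. -/
theorem IsCanonicalModule.projective_of_hom (hR : IsCohenMacaulayLocalRing R) {ω : Type u}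
    [AddCommGroup ω] [Module R ω] (hω : IsCanonicalModule R ω)
    {N : Type u} [AddCommGroup N] [Module R N] [Module.Finite R N]
    (hN : ∀ i, Subsingleton (Ext (ModuleCat.of R N) (ModuleCat.of R ω) (i + 1)))
    (hX : HasFiniteInjDim R (N →ₗ[R] ω)) : Module.Projective R N := by
  obtain ⟨d, hd⟩ : ∃ d : ℕ, ringKrullDim R = d := by
    obtain ⟨d, hd⟩ := WithBot.ne_bot_iff_exists.1 (ringKrullDim_ne_bot (R := R))
    have hd' : d ≠ ⊤ := fun h ↦ ringKrullDim_ne_top (R := R) (by rw [← hd, h]; rfl)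
    exact ⟨d.toNat, by rw [← hd, ← ENat.natCast_toNat hd']; rfl⟩
  have hk (j : ℕ) (hj : j < d) : Subsingleton
      (Ext (ModuleCat.of R (ResidueField R)) (ModuleCat.of R ω) j) :=
    subsingleton_ext_residueField_of_lt hω.toIsCohenMacaulayModule (hω.dim_eq.trans hd) hj
  obtain ⟨n₀, g₀, hg₀, hmin₀⟩ := exists_minimal_free_cover (R := R) N
  obtain ⟨n₁, g₁, hg₁, hmin₁⟩ := exists_minimal_free_cover (R := R) (LinearMap.ker g₀)
  have hK (i : ℕ) : Subsingleton
      (Ext (ModuleCat.of R (LinearMap.ker g₀)) (ModuleCat.of R ω) (i + 1)) := by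
    obtain ⟨e⟩ := nonempty_ext_ker_linearEquiv (ω := ω) hg₀ i
    have := hN (i + 1)
    exact e.symm.toEquiv.subsingleton
  have hX₁ : HasFiniteInjDim R (LinearMap.ker g₀ →ₗ[R] ω) :=
    hX.right_of_exact (hω.finite_injDim.hom_pi n₀) (LinearMap.lcomp_injective_of_surjective g₀ hg₀)
      (exact_lcomp_ker hg₀) (surjective_lcomp_ker hg₀ (hN 0))
  have h₁ := subsingleton_ext_hom_ker hk hN
    (hX.subsingleton_ext_residueField hR hd d.lt_succ_self) hg₀ hmin₀
  have h₂ := subsingleton_ext_hom_ker hk hK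
    (hX₁.subsingleton_ext_residueField hR hd d.lt_succ_self) hg₁ hmin₁
  -- Both ends of `0 → K₀† → F₁† → K₁† → 0` have zero `Ext^d(k, -)`.
  have hF := subsingleton_ext_X₂ (shortExact_lcomp_ker hg₁ (hK 0)) h₁ h₂
  have hn₁ : n₁ = 0 := by
    by_contra hne
    have := hω.nontrivial_ext hd
    let i : Fin n₁ := ⟨0, Nat.pos_of_ne_zero hne⟩
    -- If `F₁ ≠ 0`, then `ω` is a direct summand of `F₁†`, so `Ext^d(k, ω)` would vanish.
    let r : Retract (ModuleCat.of R ω) (ModuleCat.of R ((Fin n₁ → R) →ₗ[R] ω)) :=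
      { i := ModuleCat.ofHom (((Pi.basisFun R (Fin n₁)).constr R).toLinearMap ∘ₗ
          LinearMap.single R (fun _ ↦ ω) i)
        r := ModuleCat.ofHom (LinearMap.proj i ∘ₗ
          ((Pi.basisFun R (Fin n₁)).constr R).symm.toLinearMap)
        retract := by ext; simp }
    exact not_subsingleton _ (subsingleton_ext_of_retract r hF)
  subst hn₁
  have hker : LinearMap.ker g₀ = ⊥ := by
    rw [← Submodule.subsingleton_iff_eq_bot]
    exact hg₁.subsingleton
  exact Module.Projective.of_equiv (LinearEquiv.ofBijective g₀ ⟨LinearMap.ker_eq_bot.1 hker, hg₀⟩)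

/-- Induction on the vanishing bound `n`: a syzygy lowers it by one, at the cost of one in
projective dimension. -/
theorem IsCanonicalModule.hasFiniteProjDim_of_ext (hR : IsCohenMacaulayLocalRing R) {ω : Type u}
    [AddCommGroup ω] [Module R ω] (hω : IsCanonicalModule R ω) (n : ℕ)
    {M : Type u} [AddCommGroup M] [Module R M] [Module.Finite R M]
    (hvan : ∀ i, n ≤ i → Subsingleton (Ext (ModuleCat.of R M) (ModuleCat.of R ω) (i + 1)))
    (hHom : HasFiniteInjDim R (M →ₗ[R] ω))
    (hExt : ∀ i, HasFiniteInjDim R (extModule R M ω (i + 1))) :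
    HasFiniteProjDim R M := by
  rw [HasFiniteProjDim, projectiveDimension_ne_top_iff]
  induction n generalizing M with
  | zero =>
    have := hω.projective_of_hom hR (fun i ↦ hvan i i.zero_le) hHom
    have : Projective (ModuleCat.of R M) := (IsProjective.iff_projective M).1 this
    exact ⟨0, inferInstanceAs (HasProjectiveDimensionLT (ModuleCat.of R M) 1)⟩
  | succ n ih =>
    obtain ⟨m, g, hg⟩ := Module.Finite.exists_fin' R M
    obtain ⟨a, ha⟩ := ih (M := LinearMap.ker g)
      (fun i hi ↦ by
        obtain ⟨e⟩ := nonempty_ext_ker_linearEquiv (ω := ω) hg i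
        have := hvan (i + 1) (by omega)
        exact e.symm.toEquiv.subsingleton)
      ((hω.finite_injDim.hom_pi m).hom_ker hg hHom (hExt 0))
      (fun i ↦ by
        obtain ⟨e⟩ := nonempty_ext_ker_linearEquiv (ω := ω) hg i
        exact (hExt (i + 1)).of_linearEquiv e)
    have hF : Projective (ModuleCat.of R (Fin m → R)) :=
      (IsProjective.iff_projective _).1 inferInstance
    have hF1 : HasProjectiveDimensionLT (ModuleCat.of R (Fin m → R)) 1 := inferInstance
    exact ⟨a + 1, (shortExact_ker hg).hasProjectiveDimensionLT_X₃ (a + 1) ha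
      (hasProjectiveDimensionLT_of_ge _ 1 _ (by omega))⟩

end Main

theorem mainTheorem9 (R : Type u) [CommRing R] [IsLocalRing R] [IsNoetherianRing R]
    (hR : IsCohenMacaulayLocalRing R)
    (ω : Type u) [AddCommGroup ω] [Module R ω] (hω : IsCanonicalModule R ω)
    (M : Type u) [AddCommGroup M] [Module R M] [Module.Finite R M]
    (hExt : ∀ i : ℕ, HasFiniteInjDim R (extModule R M ω i)) :
    HasFiniteProjDim R M := by
  obtain ⟨n, hn⟩ := hasFiniteInjDim_iff.1 hω.finite_injDim
  refine hω.hasFiniteProjDim_of_ext hR n (fun i hi ↦ ?_) ?_ fun i ↦ hExt (i + 1)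
  · have := hn i hi
    exact HasInjectiveDimensionLT.subsingleton (ModuleCat.of R ω) i (i + 1) i.le_succ _
  · exact (hExt 0).of_linearEquiv
      ((Ext.linearEquiv₀ (R := R)).trans (ModuleCat.homLinearEquiv (S := R)))
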